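/- Let $\Omega\subset\mathbb R^2$ be a simply connected polygonal domain, i.e. a bounded, nonempty, connected and simply connected open set whose boundary is a finite disjoint union of simple closed polygons. Let $(\cdot,\cdot)$ be the inner product of $L^2(\Omega)$ and of $L^2(\Omega)^2$, and put $$V:=H_0(\mathrm{div};\Omega)=\{v\in L^2(\Omega)^2:\ \mathrm{div}\,v\in L^2(\Omega),\ v\cdot n=0\text{ on }\partial\Omega\},\qquad Q:=H^1_0(\Omega),$$ where the derivatives are weak and $v\cdot n=0$ on $\partial\Omega$ means that $(\mathrm{div}\,v,q)+(v,\nabla q)=0$ for all $q\in H^1(\Omega)$. For $q\in H^1(\Omega)$ let $\mathrm{Curl}\,q=(\partial q/\partial x_2,\,-\partial q/\partial x_1)^\top$. Consider, for $\lambda\in\mathbb R$ and $u\in V$ with $u\neq0$, the following two problems. (P) $\lambda\neq 0$ and $(\mathrm{div}\,u,\mathrm{div}\,v)=\lambda(u,v)$ for all $v\in V$. (K) For some $p\in Q$, $$(\mathrm{div}\,u,\mathrm{div}\,v)+(v,\mathrm{Curl}\,p)=\lambda(u,v)\quad\forall v\in V,\qquad (u,\mathrm{Curl}\,q)=0\quad\forall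 q\in Q.$$ If $(\lambda,u)$ solves (P), then $(\lambda,u)$ solves (K) with $p=0$. Conversely, if $(\lambda,u)$ solves (K) for some $p\in Q$, then $p=0$ and $(\lambda,u)$ solves (P); in particular $\lambda\neq0$. -/

import Mathlib

open MeasureTheory Filter Topology TopologicalSpace
open scoped Distributions ContDiff

noncomputable section

namespace AcousticEigenproblem

/-- The Euclidean plane. -/
abbrev Plane : Type := EuclideanSpace ℝ (Fin 2)

/-- A simple closed polygon with `n` vertices: there are at least three vertices, they are pairwise
distinct, and two different edges meet at most in a common endpoint. -/
def IsSimplePolygon {n : ℕ} (P : Polygon Plane n) : Prop :=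
  3 ≤ n ∧ Function.Injective P.vertices ∧
    ∀ i j : Fin n, i ≠ j →
      P.edgeSet ℝ i ∩ P.edgeSet ℝ j ⊆
        {P i, P (finRotate n i)} ∩ {P j, P (finRotate n j)}

/-- A polygonal domain: a bounded, nonempty, connected open set whose boundary is the disjoint
union of finitely many simple closed polygons. -/
def IsPolygonalDomain (Ω : Opens Plane) : Prop :=
  IsConnected (Ω : Set Plane) ∧ Bornology.IsBounded (Ω : Set Plane) ∧
    ∃ (m : ℕ) (n : Fin m → ℕ) (P : (k : Fin m) → Polygon Plane (n k)),
      (∀ k, IsSimplePolygon (P k)) ∧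
      (∀ k l, k ≠ l → Disjoint ((P k).boundary ℝ) ((P l).boundary ℝ)) ∧
      frontier (Ω : Set Plane) = ⋃ k, (P k).boundary ℝ

/-- `L²(Ω)`. -/
abbrev L2 (Ω : Opens Plane) : Type := Lp ℝ 2 (volume.restrict (Ω : Set Plane))

/-- `L²(Ω)²`, with the inner product `∫_Ω u · v`. -/
abbrev L2vec (Ω : Opens Plane) : Type := Lp Plane 2 (volume.restrict (Ω : Set Plane))

variable {Ω : Opens Plane}

/-- `g` is the weak (distributional) gradient of `q` in `Ω`. -/
def HasWeakGrad (q : L2 Ω) (g : L2vec Ω) : Prop :=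
  ∀ (φ : 𝓓(Ω, ℝ)) (i : Fin 2),
    ∫ x in (Ω : Set Plane), q x * (gradient φ x) i = -∫ x in (Ω : Set Plane), (g x) i * φ x

/-- `d` is the weak (distributional) divergence of `v` in `Ω`. -/
def HasWeakDiv (v : L2vec Ω) (d : L2 Ω) : Prop :=
  ∀ φ : 𝓓(Ω, ℝ),
    ∫ x in (Ω : Set Plane), inner ℝ (v x) (gradient φ x) = -∫ x in (Ω : Set Plane), d x * φ x

/-- Fundamental lemma of the calculus of variations. -/
theorem ae_eq_of_integral_mul_test {f g : Plane → ℝ}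
    (hf : MemLp f 2 (volume.restrict (Ω : Set Plane)))
    (hg : MemLp g 2 (volume.restrict (Ω : Set Plane)))
    (h : ∀ φ : 𝓓(Ω, ℝ), ∫ x in (Ω : Set Plane), f x * φ x = ∫ x in (Ω : Set Plane), g x * φ x) :
    f =ᵐ[volume.restrict (Ω : Set Plane)] g := by
  have hloc : ∀ {k : Plane → ℝ}, MemLp k 2 (volume.restrict (Ω : Set Plane)) →
      LocallyIntegrable k (volume.restrict (Ω : Set Plane)) :=
    fun hk => hk.locallyIntegrable (by norm_num)
  have key : ∀ᵐ x ∂(volume : Measure Plane), x ∈ (Ω : Set Plane) → f x - g x = 0 := by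
    refine IsOpen.ae_eq_zero_of_integral_contDiff_smul_eq_zero Ω.isOpen (f := fun x => f x - g x)
      ?_ ?_
    · exact locallyIntegrableOn_of_locallyIntegrable_restrict ((hloc hf).sub (hloc hg))
    · intro φ hφ hc hs
      let ψ : 𝓓(Ω, ℝ) := ⟨φ, hφ, hc, hs⟩
      have hψ : ∀ x, ψ x = φ x := fun _ => rfl
      have hi : ∀ {k : Plane → ℝ}, MemLp k 2 (volume.restrict (Ω : Set Plane)) →
          Integrable (fun x => k x * φ x) (volume.restrict (Ω : Set Plane)) := by
        intro k hk
        have := (hloc hk).integrable_smul_left_of_hasCompactSupport hφ.continuous hc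
        simpa [mul_comm] using this
      have h0 := h ψ
      simp only [hψ] at h0
      have h1 : ∫ x in (Ω : Set Plane), φ x • (f x - g x) = 0 := by
        have : (fun x => φ x • (f x - g x)) = fun x => f x * φ x - g x * φ x := by
          funext x; simp only [smul_eq_mul]; ring
        rw [this, integral_sub (hi hf) (hi hg), h0, sub_self]
      rw [← h1, setIntegral_eq_integral_of_forall_compl_eq_zero]
      intro x hx
      have : φ x = 0 := by
        by_contra hne
        exact hx (hs (subset_tsupport φ hne))
      simp [this]
  rw [EventuallyEq, ae_restrict_iff' Ω.isOpen.measurableSet]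
  filter_upwards [key] with x hx hxΩ
  exact sub_eq_zero.mp (hx hxΩ)

/-- The weak divergence is unique. -/
theorem HasWeakDiv.unique {v : L2vec Ω} {d d' : L2 Ω} (h : HasWeakDiv v d)
    (h' : HasWeakDiv v d') : d = d' := by
  apply Lp.ext
  refine ae_eq_of_integral_mul_test (Lp.memLp d) (Lp.memLp d') fun φ => ?_
  exact neg_injective ((h φ).symm.trans (h' φ))

/-- The weak gradient is unique. -/
theorem HasWeakGrad.unique {q : L2 Ω} {g g' : L2vec Ω} (h : HasWeakGrad q g)
    (h' : HasWeakGrad q g') : g = g' := by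
  have key : ∀ i : Fin 2, (fun x => (g x) i) =ᵐ[volume.restrict (Ω : Set Plane)]
      fun x => (g' x) i := by
    intro i
    refine ae_eq_of_integral_mul_test ?_ ?_ fun φ => ?_
    · exact (EuclideanSpace.proj (𝕜 := ℝ) i).comp_memLp' (Lp.memLp g)
    · exact (EuclideanSpace.proj (𝕜 := ℝ) i).comp_memLp' (Lp.memLp g')
    · exact neg_injective ((h φ i).symm.trans (h' φ i))
  apply Lp.ext
  filter_upwards [key 0, key 1] with x h0 h1
  ext i
  fin_cases i
  · exact h0
  · exact h1

/-- `H¹(Ω)`. -/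
def H1 (Ω : Opens Plane) : Set (L2 Ω) := {q | ∃ g, HasWeakGrad q g}

open Classical in
/-- The weak gradient of `q ∈ H¹(Ω)` (and `0` for `q ∉ H¹(Ω)`). -/
def weakGrad (q : L2 Ω) : L2vec Ω := if h : ∃ g, HasWeakGrad q g then h.choose else 0

/-- The clockwise quarter turn `(a, b) ↦ (b, -a)`. -/
def quarterTurn : Plane →L[ℝ] Plane :=
  Matrix.toEuclideanCLM (n := Fin 2) (𝕜 := ℝ) !![0, 1; -1, 0]

/-- `Curl q = (∂q/∂x₂, -∂q/∂x₁)` for `q ∈ H¹(Ω)`. -/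
def weakCurl (q : L2 Ω) : L2vec Ω := quarterTurn.compLp (weakGrad q)

/-- `H(div; Ω)`. -/
def Hdiv (Ω : Opens Plane) : Set (L2vec Ω) := {v | ∃ d, HasWeakDiv v d}

open Classical in
/-- The weak divergence of `v ∈ H(div; Ω)` (and `0` for `v ∉ H(div; Ω)`). -/
def weakDiv (v : L2vec Ω) : L2 Ω := if h : ∃ d, HasWeakDiv v d then h.choose else 0

/-- `H¹₀(Ω)`: the functions of `H¹(Ω)` with zero trace on `∂Ω`, that is, the closure of the test
functions on `Ω` in the norm of `H¹(Ω)`. -/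
def H10 (Ω : Opens Plane) : Set (L2 Ω) :=
  {q | q ∈ H1 Ω ∧ ∃ φ : ℕ → 𝓓(Ω, ℝ),
    Tendsto (fun k => eLpNorm (fun x => φ k x - q x) 2 (volume.restrict (Ω : Set Plane)))
      atTop (𝓝 0) ∧
    Tendsto (fun k => eLpNorm (fun x => gradient (φ k) x - weakGrad q x) 2
      (volume.restrict (Ω : Set Plane))) atTop (𝓝 0)}

/-- The normal trace of `v ∈ H(div; Ω)` on `∂Ω`, as the functional
`q ↦ ⟨v · n, q⟩ = (div v, q) + (v, grad q)` on `H¹(Ω)`. -/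
def normalTrace (v : L2vec Ω) (q : L2 Ω) : ℝ :=
  inner ℝ (weakDiv v) q + inner ℝ v (weakGrad q)

/-- `H₀(div; Ω)`: the fields of `H(div; Ω)` with `v · n = 0` on `∂Ω`. -/
def H0div (Ω : Opens Plane) : Set (L2vec Ω) :=
  {v | v ∈ Hdiv Ω ∧ ∀ q ∈ H1 Ω, normalTrace v q = 0}

/-- `(lam, u)` solves the eigenproblem `(div u, div v) = lam (u, v)` on `H₀(div; Ω)`, with
`lam ≠ 0`. -/
def IsEigenpair (lam : ℝ) (u : L2vec Ω) : Prop :=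
  u ∈ H0div Ω ∧ u ≠ 0 ∧
    (∀ v ∈ H0div Ω, inner ℝ (weakDiv u) (weakDiv v) = lam * inner ℝ u v) ∧
    lam ≠ 0

/-- `(lam, u)` solves the rotated Kikuchi mixed formulation, with multiplier `p`. -/
def IsMixedEigenpair (lam : ℝ) (u : L2vec Ω) (p : L2 Ω) : Prop :=
  u ∈ H0div Ω ∧ u ≠ 0 ∧ p ∈ H10 Ω ∧
    (∀ v ∈ H0div Ω,
      inner ℝ (weakDiv u) (weakDiv v) + inner ℝ v (weakCurl p) = lam * inner ℝ u v) ∧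
    ∀ q ∈ H10 Ω, inner ℝ u (weakCurl q) = 0

end AcousticEigenproblem

end

open AcousticEigenproblem

/-!
A field `Curl p` with `p ∈ H¹₀(Ω)` is orthogonal to all gradients of `H¹(Ω)`: for a test function
`p` this is the symmetry of second derivatives, and the general case follows by density
(`inner_weakCurl_weakGrad`). Hence `Curl p` lies in `H₀(div; Ω)` and has divergence zero. Inserting
`v = Curl q` in the eigenproblem with `λ ≠ 0` shows that its solutions satisfy the constraint of the
mixed problem. Inserting `v = Curl p` in the mixed problem shows that `Curl p = 0`, so `p = 0` by a
Poincaré inequality on the bounded set `Ω` (`eq_zero_of_weakGrad_eq_zero`).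

It remains to exclude `λ = 0` in the mixed problem. In that case `div u = 0` and, by the constraint,
`rot u = 0`, and it has to be seen that `u = 0` (`eq_zero_of_harmonic_field`).

* The complex function `u₁ - i u₂` is a weak solution of the Cauchy-Riemann equations, so it agrees
  almost everywhere with a holomorphic function
  (`exists_differentiableOn_ae_eq_of_weak_cauchyRiemann`). The reason is that its mollifications are
  holomorphic, hence are reproduced by averaging against a radial weight, which makes them
  independent of the mollification parameter in the limit.
* A holomorphic function has primitives on discs. On the simply connected set `Ω` these can be glued
  (`exists_hasFDerivAt_of_locally`), since the local primitives form a covering space of `Ω`, which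
  has a section. The real part `q` of the primitive is a potential: `u = ∇q`.
* The potential is not known to be square integrable up to the boundary, but `arctan q` is bounded
  and belongs to `H¹(Ω)`, with gradient `u / (1 + q²)`. Testing `div u = 0`, `u · n = 0` with
  `arctan q` gives `∫ |u|² / (1 + q²) = 0`, so `u = 0`. No regularity of the boundary is needed.
-/

/-! ### Closed forms on simply connected sets -/

/-- A `1`-cocycle of locally constant functions, relative to an open cover of a simply connected,
locally path connected space, is a coboundary: the cocycle is the clutching datum of a covering map
with fibre `A`, and this covering map has a section. -/
theorem exists_eventually_add_eq_of_cocycle {X A : Type*} [TopologicalSpace X]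
    [SimplyConnectedSpace X] [LocallyPathConnectedSpace X] [AddCommGroup A]
    (V : X → Set X) (hV : ∀ i, IsOpen (V i)) (hmem : ∀ x, x ∈ V x) (c : X → X → X → A)
    (hc : ∀ i j, ∀ x ∈ V i ∩ V j, ∀ᶠ y in 𝓝 x, c i j y = c i j x)
    (hself : ∀ i, ∀ x ∈ V i, c i i x = 0)
    (hcomp : ∀ i j k, ∀ x ∈ V i ∩ V j ∩ V k, c i j x + c j k x = c i k x) :
    ∃ v : X → A, ∀ i, ∀ x ∈ V i, ∀ᶠ y in 𝓝 x, c y i y + v y = c x i x + v x := by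
  let _ : TopologicalSpace A := ⊥
  have : DiscreteTopology A := ⟨rfl⟩
  let Z : FiberBundleCore X X A :=
    { baseSet := V
      isOpen_baseSet := hV
      indexAt := id
      mem_baseSet_at := hmem
      coordChange := fun i j x a => c i j x + a
      coordChange_self := fun i x hx a => by rw [hself i x hx, zero_add]
      continuousOn_coordChange := by
        rintro i j ⟨x, a⟩ ⟨hx, -⟩
        refine ContinuousAt.continuousWithinAt ?_
        refine (continuousAt_const (y := c i j x + a)).congr ?_
        have h1 : ∀ᶠ p : X × A in 𝓝 (x, a), c i j p.1 = c i j x :=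
          (continuousAt_fst (p := (x, a))).eventually (hc i j x hx)
        have h2 : ∀ᶠ p : X × A in 𝓝 (x, a), p.2 = a :=
          (continuousAt_snd (p := (x, a))).eventually (p := fun b => b = a) (by simp [nhds_discrete])
        filter_upwards [h1, h2] with p hp1 hp2
        rw [hp1, hp2]
      coordChange_comp := fun i j k x hx a => by
        rw [← hcomp i j k x hx]; abel }
  have hcov : IsCoveringMap (Bundle.TotalSpace.proj : Z.TotalSpace → X) :=
    FiberBundle.isCoveringMap
  have hne : Nonempty X := inferInstance
  obtain ⟨x₀⟩ := hne
  obtain ⟨s, ⟨-, hs⟩, -⟩ := hcov.existsUnique_continuousMap_lifts (ContinuousMap.id X) x₀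
    (⟨x₀, (0 : A)⟩ : Z.TotalSpace) rfl
  have hs' : ∀ x, (s x).1 = x := fun x => congrFun hs x
  let v : X → A := fun x => (s x).2
  have hcoord : ∀ i y, ((Z.localTriv i) (s y)).2 = c y i y + v y := by
    intro i y
    rw [Z.localTriv_apply]
    change c (s y).1 i (s y).1 + v y = _
    rw [hs']
  refine ⟨v, fun i x hx => ?_⟩
  have hcont : ContinuousAt (fun y => ((Z.localTriv i) (s y)).2) x := by
    refine continuousAt_snd.comp ?_
    refine ContinuousAt.comp ?_ s.continuous.continuousAt
    refine (Z.localTriv i).continuousAt ?_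
    rw [Z.mem_localTriv_source, hs']
    exact hx
  have := hcont.eventually (p := fun a => a = ((Z.localTriv i) (s x)).2) (by simp [nhds_discrete])
  filter_upwards [this] with y hy
  rwa [hcoord, hcoord] at hy

/-- A `1`-form that is locally the derivative of a function on a simply connected open set is
globally the derivative of a function there. -/
theorem exists_hasFDerivAt_of_locally {E F : Type*} [NormedAddCommGroup E] [NormedSpace ℝ E]
    [NormedAddCommGroup F] [NormedSpace ℝ F] {U : Set E} (hU : IsOpen U)
    (hsc : SimplyConnectedSpace U) {η : E → E →L[ℝ] F}
    (hloc : ∀ x ∈ U, ∃ r > 0, ∃ g : E → F, ∀ y ∈ Metric.ball x r, HasFDerivAt g (η y) y) :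
    ∃ g : E → F, ∀ x ∈ U, HasFDerivAt g (η x) x := by
  classical
  have : LocallyPathConnectedSpace U := hU.locallyPathConnectedSpace
  choose! r hr g hg using hloc
  obtain ⟨v, hv⟩ := exists_eventually_add_eq_of_cocycle (X := U) (A := F)
    (fun i => {y | (y : E) ∈ Metric.ball (i : E) (r i)})
    (fun i => Metric.isOpen_ball.preimage continuous_subtype_val)
    (fun x => Metric.mem_ball_self (hr x x.2))
    (fun i j x => g i x - g j x)
    (by
      rintro i j x ⟨hxi, hxj⟩
      -- two local potentials have the same derivative on a small ball
      obtain ⟨ε, hε, hsub⟩ := Metric.isOpen_iff.1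
        (Metric.isOpen_ball.inter Metric.isOpen_ball) (x : E) ⟨hxi, hxj⟩
      have hd : ∀ y ∈ Metric.ball (x : E) ε,
          HasFDerivAt (fun z => g i z - g j z) (0 : E →L[ℝ] F) y := by
        intro y hy
        simpa using (hg i i.2 y (hsub hy).1).fun_sub (hg j j.2 y (hsub hy).2)
      have hball : ∀ᶠ y : U in 𝓝 x, (y : E) ∈ Metric.ball (x : E) ε :=
        continuous_subtype_val.continuousAt.eventually (Metric.ball_mem_nhds _ hε)
      filter_upwards [hball] with y hy
      exact (convex_ball (x : E) ε).is_const_of_fderivWithin_eq_zero (𝕜 := ℝ)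
        (f := fun z => g i z - g j z)
        (fun z hz => (hd z hz).differentiableAt.differentiableWithinAt)
        (fun z hz => by
          rw [fderivWithin_of_isOpen Metric.isOpen_ball hz]; exact (hd z hz).fderiv)
        hy (Metric.mem_ball_self hε))
    (fun i x _ => sub_self _)
    (fun i j k x _ => by abel)
  -- the cocycle condition on `v` says that this function differs from each local potential by a
  -- locally constant function
  let G : E → F := fun x => if h : x ∈ U then g x x + v ⟨x, h⟩ else 0
  refine ⟨G, fun x hx => ?_⟩
  have h1 := hv ⟨x, hx⟩ ⟨x, hx⟩ (Metric.mem_ball_self (hr x hx))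
  rw [nhds_subtype_eq_comap, eventually_comap] at h1
  have h2 : G =ᶠ[𝓝 x] fun y => g x y + v ⟨x, hx⟩ := by
    filter_upwards [h1, hU.mem_nhds hx] with y hy hyU
    have := hy ⟨y, hyU⟩ rfl
    simp only [sub_self, zero_add] at this
    simp only [G, dif_pos hyU, ← this]
    abel
  exact ((hg x hx x (Metric.mem_ball_self (hr x hx))).add_const _).congr_of_eventuallyEq h2

/-! ### Weak solutions of the Cauchy-Riemann equations -/

section CauchyRiemann

open Complex ContinuousLinearMap
open scoped Convolution

/-- A smooth mollifier on the plane depending only on the modulus. Radial symmetry is what makes it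
reproduce holomorphic functions. -/
theorem exists_radial_mollifier {ε : ℝ} (hε : 0 < ε) :
    ∃ ρ : ℂ → ℝ, ContDiff ℝ ∞ ρ ∧ (∀ y, ε < ‖y‖ → ρ y = 0) ∧ ∫ y, ρ y = 1 ∧
      ∀ y z, ‖y‖ = ‖z‖ → ρ y = ρ z := by
  let b : ContDiffBump (0 : ℝ) := ⟨ε ^ 2 / 2, ε ^ 2, by positivity, half_lt_self (by positivity)⟩
  let σ : ℂ → ℝ := fun y => b (‖y‖ ^ 2)
  have hσ : ContDiff ℝ ∞ σ := b.contDiff.comp (contDiff_norm_sq ℝ)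
  have hσ0 : ∀ y, ε < ‖y‖ → σ y = 0 := by
    intro y hy
    refine b.zero_of_le_dist ?_
    change ε ^ 2 ≤ dist (‖y‖ ^ 2) 0
    rw [Real.dist_0_eq_abs, abs_of_nonneg (by positivity)]
    gcongr
  have hσc : HasCompactSupport σ :=
    HasCompactSupport.intro (isCompact_closedBall (0 : ℂ) ε) fun y hy => hσ0 y (by simpa using hy)
  have hpos : 0 < ∫ y, σ y := by
    refine hσ.continuous.integral_pos_of_hasCompactSupport_nonneg_nonzero hσc
      (fun y => b.nonneg) (x := 0) ?_
    have : σ 0 = 1 := b.one_of_mem_closedBall (by simp [b.rIn_pos.le])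
    rw [this]
    exact one_ne_zero
  refine ⟨fun y => (∫ y, σ y)⁻¹ * σ y, contDiff_const.mul hσ, fun y hy => ?_, ?_, fun y z h => ?_⟩
  · simp [hσ0 y hy]
  · rw [integral_const_mul, inv_mul_cancel₀ hpos.ne']
  · simp only [σ, h]

/-- Averaging a holomorphic function with a radial weight of total mass one gives back its value at
the centre, by the mean value property on circles. -/
theorem integral_radial_smul_eq {ρ : ℂ → ℝ} {ε R : ℝ} (hεR : ε < R) (hρ : Continuous ρ)
    (hsupp : ∀ y, ε < ‖y‖ → ρ y = 0) (hint : ∫ y, ρ y = 1)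
    (hrad : ∀ y z, ‖y‖ = ‖z‖ → ρ y = ρ z) {g : ℂ → ℂ} (hg : Continuous g) {x : ℂ}
    (hd : DifferentiableOn ℂ g (Metric.ball x R)) :
    ∫ y, ρ y • g (x - y) = g x := by
  have hρc : HasCompactSupport ρ :=
    HasCompactSupport.intro (isCompact_closedBall (0 : ℂ) ε) fun y hy => hsupp y (by simpa using hy)
  have hρi : Integrable ρ := hρ.integrable_of_hasCompactSupport hρc
  have hnorm : ∀ θ : ℝ, ‖circleMap 0 1 θ‖ = 1 := fun θ => by simp
  -- rotating the variable does not change the integral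
  have hrot : ∀ θ : ℝ, ∫ y, ρ y • g (x + circleMap 0 1 θ * y) = ∫ y, ρ y • g (x - y) := by
    intro θ
    have hcirc : -circleMap 0 1 θ ∈ Submonoid.unitSphere ℂ := by simp [Submonoid.unitSphere]
    let e : ℂ ≃ₗᵢ[ℝ] ℂ := rotation ⟨-circleMap 0 1 θ, hcirc⟩
    have he : ∀ y, e y = -circleMap 0 1 θ * y := fun y => rotation_apply _ _
    rw [← e.measurePreserving.integral_comp' (f := e.toHomeomorph.toMeasurableEquiv)
      (fun y => ρ y • g (x - y))]
    refine integral_congr_ae (Eventually.of_forall fun y => ?_)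
    change _ = ρ (e y) • g (x - e y)
    rw [hrad (e y) y (e.norm_map y), he, neg_mul, sub_neg_eq_add]
  have hmean : ∀ y, ρ y • Real.circleAverage (fun w => g (x + w * y)) 0 1 = ρ y • g x := by
    intro y
    rcases lt_or_ge ε ‖y‖ with hy | hy
    · simp [hsupp y hy]
    congr 1
    rw [DiffContOnCl.circleAverage]
    · simp
    · refine DifferentiableOn.diffContOnCl fun w hw => ?_
      rw [abs_one, closure_ball _ one_ne_zero, mem_closedBall_zero_iff] at hw
      have hmem : x + w * y ∈ Metric.ball x R := by
        rw [mem_ball_iff_norm, add_sub_cancel_left, norm_mul]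
        nlinarith [norm_nonneg y]
      have h1 : DifferentiableAt ℂ g (x + w * y) :=
        hd.differentiableAt (Metric.isOpen_ball.mem_nhds hmem)
      have h2 : DifferentiableAt ℂ (fun w => x + w * y) w := by fun_prop
      exact (h1.comp w h2).differentiableWithinAt
  obtain ⟨M, hM⟩ := (isCompact_closedBall x ε).exists_bound_of_continuousOn hg.continuousOn
  have hprod : Integrable (Function.uncurry fun (θ : ℝ) (y : ℂ) =>
      ρ y • g (x + circleMap 0 1 θ * y))
      ((volume.restrict (Set.Ioc 0 (2 * Real.pi))).prod volume) := by
    have hb : Integrable (fun p : ℝ × ℂ => (1 : ℝ) * (‖ρ p.2‖ * M))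
        ((volume.restrict (Set.Ioc 0 (2 * Real.pi))).prod volume) :=
      Integrable.mul_prod (f := fun _ : ℝ => (1 : ℝ)) (g := fun y : ℂ => ‖ρ y‖ * M)
        (integrable_const _) (hρi.norm.mul_const M)
    refine hb.mono' (Continuous.aestronglyMeasurable ?_) (Eventually.of_forall ?_)
    · have := continuous_circleMap 0 1
      change Continuous fun p : ℝ × ℂ => ρ p.2 • g (x + circleMap 0 1 p.1 * p.2)
      fun_prop
    · rintro ⟨θ, y⟩
      simp only [Function.uncurry, one_mul, norm_smul]
      rcases lt_or_ge ε ‖y‖ with hy | hy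
      · simp [hsupp y hy]
      · refine mul_le_mul_of_nonneg_left (hM _ ?_) (norm_nonneg _)
        rw [mem_closedBall_iff_norm, add_sub_cancel_left, norm_mul, hnorm, one_mul]
        exact hy
  have key : ∫ θ in (0 : ℝ)..2 * Real.pi, ∫ y, ρ y • g (x + circleMap 0 1 θ * y) =
      ∫ y, ∫ θ in (0 : ℝ)..2 * Real.pi, ρ y • g (x + circleMap 0 1 θ * y) := by
    simp only [intervalIntegral.integral_of_le Real.two_pi_pos.le]
    exact integral_integral_swap hprod
  have hL : ∫ θ in (0 : ℝ)..2 * Real.pi, ∫ y, ρ y • g (x + circleMap 0 1 θ * y) =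
      (2 * Real.pi) • ∫ y, ρ y • g (x - y) := by
    simp only [hrot, intervalIntegral.integral_const, sub_zero]
  have hR : ∫ y, ∫ θ in (0 : ℝ)..2 * Real.pi, ρ y • g (x + circleMap 0 1 θ * y) =
      (2 * Real.pi) • g x := by
    have : ∀ y, ∫ θ in (0 : ℝ)..2 * Real.pi, ρ y • g (x + circleMap 0 1 θ * y) =
        (2 * Real.pi) • (ρ y • g x) := by
      intro y
      rw [← hmean y, Real.circleAverage_def, intervalIntegral.integral_smul, smul_comm (ρ y),
        smul_inv_smul₀ Real.two_pi_pos.ne']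
    simp only [this]
    rw [integral_smul, integral_smul_const, hint, one_smul]
  rw [hL, hR] at key
  exact smul_right_injective ℂ Real.two_pi_pos.ne' key

/-- Mollifying a weak solution of the Cauchy-Riemann equations gives a holomorphic function at all
points whose distance to the complement exceeds the radius of the mollifier. -/
theorem differentiableAt_convolution_of_weak_cauchyRiemann {U : Set ℂ} {F : ℂ → ℂ}
    (hF : Integrable F)
    (hCR : ∀ ψ : ℂ → ℝ, ContDiff ℝ ∞ ψ → HasCompactSupport ψ → tsupport ψ ⊆ U →
      ∫ z, fderiv ℝ ψ z I • F z = I * ∫ z, fderiv ℝ ψ z 1 • F z)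
    {ρ : ℂ → ℝ} {ε : ℝ} (hρ : ContDiff ℝ ∞ ρ) (hsupp : ∀ y, ε < ‖y‖ → ρ y = 0) {x : ℂ}
    (hx : Metric.closedBall x ε ⊆ U) :
    DifferentiableAt ℂ (ρ ⋆[lsmul ℝ ℝ, volume] F) x := by
  have hρc : HasCompactSupport ρ :=
    HasCompactSupport.intro (isCompact_closedBall (0 : ℂ) ε) fun y hy => hsupp y (by simpa using hy)
  let L : ℂ →L[ℝ] ℝ →L[ℝ] ℂ := (lsmul ℝ ℝ).flip
  have hflip : ρ ⋆[lsmul ℝ ℝ, volume] F = F ⋆[L, volume] ρ := (convolution_flip (lsmul ℝ ℝ)).symm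
  have hder := hρc.hasFDerivAt_convolution_right L hF.locallyIntegrable
    (hρ.of_le (by norm_cast)) x
  have hval : ∀ v, fderiv ℝ (F ⋆[L, volume] ρ) x v = ∫ t, fderiv ℝ ρ (x - t) v • F t := by
    intro v
    rw [hder.fderiv, convolution_precompR_apply L hF.locallyIntegrable (hρc.fderiv ℝ)
      (hρ.continuous_fderiv (by simp))]
    rfl
  let ψ : ℂ → ℝ := fun t => ρ (x - t)
  have hψ : ContDiff ℝ ∞ ψ := hρ.comp (contDiff_const.sub contDiff_id)
  have hψs : tsupport ψ ⊆ Metric.closedBall x ε := by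
    refine closure_minimal (fun t ht => ?_) Metric.isClosed_closedBall
    by_contra h
    refine ht (hsupp _ ?_)
    rw [Metric.mem_closedBall, not_le, dist_comm, dist_eq_norm] at h
    exact h
  have hψd : ∀ t v, fderiv ℝ ψ t v = -fderiv ℝ ρ (x - t) v := by
    intro t v
    have h1 : HasFDerivAt ψ ((fderiv ℝ ρ (x - t)).comp (-ContinuousLinearMap.id ℝ ℂ)) t :=
      ((hρ.differentiable (by simp)) (x - t)).hasFDerivAt.comp t
        ((hasFDerivAt_id t).const_sub x)
    rw [h1.fderiv]
    simp
  have h := hCR ψ hψ ((isCompact_closedBall x ε).of_isClosed_subset (isClosed_tsupport _) hψs)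
    (hψs.trans hx)
  simp only [hψd, neg_smul, integral_neg, mul_neg, neg_inj] at h
  rw [hflip, differentiableAt_complex_iff_differentiableAt_real]
  exact ⟨hder.differentiableAt, by rw [hval, hval, h, smul_eq_mul]⟩

/-- Two mollifications commute. -/
theorem integral_smul_convolution_comm {F : ℂ → ℂ} (hF : Integrable F) {ρ σ : ℂ → ℝ}
    (hρ : Continuous ρ) (hρc : HasCompactSupport ρ) (hσ : Integrable σ) (x : ℂ) :
    (ρ ⋆[lsmul ℝ ℝ, volume] (σ ⋆[lsmul ℝ ℝ, volume] F)) x =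
      (σ ⋆[lsmul ℝ ℝ, volume] (ρ ⋆[lsmul ℝ ℝ, volume] F)) x := by
  obtain ⟨C, hC⟩ := hρ.bounded_above_of_compact_support hρc
  have h1 : Integrable (fun p : ℂ × ℂ => σ p.2 • F (p.1 - p.2)) (volume.prod volume) :=
    hσ.convolution_integrand (lsmul ℝ ℝ) hF
  have hmp : MeasurePreserving (fun p : ℂ × ℂ => (x - p.1, p.2)) (volume.prod volume)
      (volume.prod volume) :=
    (Measure.measurePreserving_sub_left volume x).prod (MeasurePreserving.id volume)
  have h2 : Integrable (fun p : ℂ × ℂ => σ p.2 • F (x - p.1 - p.2)) (volume.prod volume) :=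
    hmp.integrable_comp_of_integrable h1
  have h3 : Integrable (Function.uncurry fun s t => ρ s • σ t • F (x - s - t))
      (volume.prod volume) :=
    h2.bdd_smul C (hρ.comp continuous_fst).aestronglyMeasurable
      (Eventually.of_forall fun p => hC p.1)
  simp only [convolution_lsmul, ← integral_smul]
  rw [integral_integral_swap h3]
  refine integral_congr_ae (Eventually.of_forall fun t => integral_congr_ae
    (Eventually.of_forall fun s => ?_))
  simp only
  rw [smul_comm, sub_right_comm]

/-- Weyl's lemma for the Cauchy-Riemann operator: an integrable weak solution agrees almost
everywhere with a holomorphic function. -/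
theorem exists_differentiableOn_ae_eq_of_weak_cauchyRiemann {U : Set ℂ} (hU : IsOpen U)
    {F : ℂ → ℂ} (hF : Integrable F)
    (hCR : ∀ ψ : ℂ → ℝ, ContDiff ℝ ∞ ψ → HasCompactSupport ψ → tsupport ψ ⊆ U →
      ∫ z, fderiv ℝ ψ z I • F z = I * ∫ z, fderiv ℝ ψ z 1 • F z) :
    ∃ f : ℂ → ℂ, DifferentiableOn ℂ f U ∧ ∀ᵐ z, z ∈ U → F z = f z := by
  have hδ : ∀ n : ℕ, (0 : ℝ) < 1 / ((n : ℝ) + 1) := fun n => Nat.one_div_pos_of_nat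
  let φ : ℕ → ContDiffBump (0 : ℂ) := fun n =>
    ⟨1 / ((n : ℝ) + 1) / 2, 1 / ((n : ℝ) + 1), half_pos (hδ n), half_lt_self (hδ n)⟩
  have hφ : Tendsto (fun n => (φ n).rOut) atTop (𝓝 0) := tendsto_one_div_add_atTop_nhds_zero_nat
  let s : ℕ → ℂ → ℂ := fun n => (φ n).normed volume ⋆[lsmul ℝ ℝ, volume] F
  have hsc : ∀ n, Continuous (s n) := fun n =>
    (φ n).hasCompactSupport_normed.continuous_convolution_left (lsmul ℝ ℝ)
      (φ n).continuous_normed hF.locallyIntegrable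
  have hφ0 : ∀ n y, (φ n).rOut < ‖y‖ → (φ n).normed volume y = 0 := by
    intro n y hy
    have : y ∉ Function.support ((φ n).normed volume) := by
      rw [(φ n).support_normed_eq, mem_ball_zero_iff]
      exact hy.le.not_gt
    simpa using this
  -- Far from the complement, the mollifications converge to a fixed radial mollification: they are
  -- holomorphic, so the radial mollifier reproduces them.
  have hlim : ∀ (ε : ℝ) (ρ : ℂ → ℝ), 0 < ε → ContDiff ℝ ∞ ρ → (∀ y, ε < ‖y‖ → ρ y = 0) →
      ∫ y, ρ y = 1 → (∀ y z, ‖y‖ = ‖z‖ → ρ y = ρ z) → ∀ x, Metric.ball x (3 * ε) ⊆ U →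
      Tendsto (fun n => s n x) atTop (𝓝 ((ρ ⋆[lsmul ℝ ℝ, volume] F) x)) := by
    intro ε ρ hε hρ hsupp hint hrad x hx
    have hρc : HasCompactSupport ρ :=
      HasCompactSupport.intro (isCompact_closedBall (0 : ℂ) ε) fun y hy =>
        hsupp y (by simpa using hy)
    have hcont : Continuous (ρ ⋆[lsmul ℝ ℝ, volume] F) :=
      hρc.continuous_convolution_left (lsmul ℝ ℝ) hρ.continuous hF.locallyIntegrable
    refine (ContDiffBump.convolution_tendsto_right_of_continuous (μ := volume) hφ hcont x).congr' ?_
    filter_upwards [hφ.eventually (gt_mem_nhds hε)] with n hn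
    rw [← integral_smul_convolution_comm hF hρ.continuous hρc (φ n).integrable_normed,
      convolution_lsmul]
    refine integral_radial_smul_eq (R := 2 * ε) (by linarith) hρ.continuous hsupp hint hrad
      (hsc n) fun z hz => ?_
    refine (differentiableAt_convolution_of_weak_cauchyRiemann hF hCR (φ n).contDiff_normed
      (hφ0 n) fun w hw => hx ?_).differentiableWithinAt
    rw [Metric.mem_closedBall] at hw
    rw [Metric.mem_ball] at hz ⊢
    linarith [dist_triangle w z x]
  let f : ℂ → ℂ := fun x => limUnder atTop fun n => s n x
  have hloc : ∀ x ∈ U, ∃ ε > 0, ∃ ρ : ℂ → ℝ, ContDiff ℝ ∞ ρ ∧ (∀ y, ε < ‖y‖ → ρ y = 0) ∧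
      Metric.ball x (4 * ε) ⊆ U ∧ ∀ z ∈ Metric.ball x ε,
        Tendsto (fun n => s n z) atTop (𝓝 ((ρ ⋆[lsmul ℝ ℝ, volume] F) z)) := by
    intro x hx
    obtain ⟨r, hr, hsub⟩ := Metric.isOpen_iff.1 hU x hx
    obtain ⟨ρ, h1, h2, h3, h4⟩ := exists_radial_mollifier (show 0 < r / 4 by positivity)
    refine ⟨r / 4, by positivity, ρ, h1, h2, ?_, fun z hz => ?_⟩
    · rwa [mul_div_cancel₀ _ (by norm_num)]
    · refine hlim (r / 4) ρ (by positivity) h1 h2 h3 h4 z fun w hw => hsub ?_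
      rw [Metric.mem_ball] at hw hz ⊢
      linarith [dist_triangle w z x]
  refine ⟨f, fun x hx => ?_, ?_⟩
  · obtain ⟨ε, hε, ρ, hρ, hsupp, hsub, ht⟩ := hloc x hx
    have heq : f =ᶠ[𝓝 x] ρ ⋆[lsmul ℝ ℝ, volume] F := by
      filter_upwards [Metric.ball_mem_nhds x hε] with z hz
      exact (ht z hz).limUnder_eq
    refine (heq.differentiableAt_iff.2 ?_).differentiableWithinAt
    exact differentiableAt_convolution_of_weak_cauchyRiemann hF hCR hρ hsupp
      ((Metric.closedBall_subset_ball (by linarith)).trans hsub)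
  · filter_upwards [ContDiffBump.ae_convolution_tendsto_right_of_locallyIntegrable (K := 2) hφ
      (Eventually.of_forall fun n => by simp only [φ]; linarith) hF.locallyIntegrable] with z hz hzU
    obtain ⟨ε, hε, ρ, -, -, -, ht⟩ := hloc z hzU
    rw [tendsto_nhds_unique hz (ht z (Metric.mem_ball_self hε))]
    exact (ht z (Metric.mem_ball_self hε)).limUnder_eq.symm

end CauchyRiemann

namespace AcousticEigenproblem

variable {Ω : Opens Plane}

/-! ### Weak derivatives and test functions -/

theorem HasWeakGrad.weakGrad_eq {q : L2 Ω} {g : L2vec Ω} (h : HasWeakGrad q g) :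
    weakGrad q = g := by
  have hex : ∃ g, HasWeakGrad q g := ⟨g, h⟩
  rw [weakGrad, dif_pos hex]
  exact hex.choose_spec.unique h

theorem HasWeakDiv.weakDiv_eq {v : L2vec Ω} {d : L2 Ω} (h : HasWeakDiv v d) :
    weakDiv v = d := by
  have hex : ∃ d, HasWeakDiv v d := ⟨d, h⟩
  rw [weakDiv, dif_pos hex]
  exact hex.choose_spec.unique h

theorem hasWeakGrad_weakGrad {q : L2 Ω} (h : q ∈ H1 Ω) : HasWeakGrad q (weakGrad q) := by
  obtain ⟨g, hg⟩ := h
  rwa [hg.weakGrad_eq]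

theorem hasWeakDiv_weakDiv {v : L2vec Ω} (h : v ∈ Hdiv Ω) : HasWeakDiv v (weakDiv v) := by
  obtain ⟨d, hd⟩ := h
  rwa [hd.weakDiv_eq]

theorem inner_gradient_eq_fderiv (f : Plane → ℝ) (x v : Plane) :
    inner ℝ (gradient f x) v = fderiv ℝ f x v := by
  rw [gradient, InnerProductSpace.toDual_symm_apply]

theorem gradient_apply (f : Plane → ℝ) (x : Plane) (i : Fin 2) :
    gradient f x i = fderiv ℝ f x (EuclideanSpace.single i 1) := by
  rw [← inner_gradient_eq_fderiv, EuclideanSpace.inner_single_right]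
  simp

theorem norm_gradient (f : Plane → ℝ) (x : Plane) : ‖gradient f x‖ = ‖fderiv ℝ f x‖ := by
  rw [gradient, LinearIsometryEquiv.norm_map]

theorem testFunction_eq_zero (φ : 𝓓(Ω, ℝ)) {x : Plane} (hx : x ∉ Ω) : φ x = 0 := by
  by_contra h
  exact hx (φ.tsupport_subset (subset_tsupport φ h))

theorem fderiv_testFunction_eq_zero (φ : 𝓓(Ω, ℝ)) {x : Plane} (hx : x ∉ Ω) :
    fderiv ℝ φ x = 0 := by
  by_contra h
  exact hx (φ.tsupport_subset (support_fderiv_subset ℝ h))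

theorem contDiff_testFunction (φ : 𝓓(Ω, ℝ)) : ContDiff ℝ ∞ φ := φ.contDiff

theorem continuous_gradient_testFunction (φ : 𝓓(Ω, ℝ)) : Continuous (gradient φ) :=
  (InnerProductSpace.toDual ℝ Plane).symm.continuous.comp
    ((contDiff_testFunction φ).continuous_fderiv (by simp))

theorem memLp_testFunction (φ : 𝓓(Ω, ℝ)) : MemLp φ 2 (volume.restrict (Ω : Set Plane)) :=
  (φ.continuous.memLp_of_hasCompactSupport φ.hasCompactSupport).restrict _

theorem memLp_gradient_testFunction (φ : 𝓓(Ω, ℝ)) :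
    MemLp (gradient φ) 2 (volume.restrict (Ω : Set Plane)) := by
  refine ((continuous_gradient_testFunction φ).memLp_of_hasCompactSupport ?_).restrict _
  exact (φ.hasCompactSupport.fderiv ℝ).comp_left
    (g := (InnerProductSpace.toDual ℝ Plane).symm) (map_zero _)

/-- The directional derivative of a test function, as a test function. -/
noncomputable def directionalDeriv (φ : 𝓓(Ω, ℝ)) (v : Plane) : 𝓓(Ω, ℝ) where
  toFun x := fderiv ℝ φ x v
  contDiff' := ((contDiff_testFunction φ).fderiv_right (m := ∞) (by simp)).clm_apply contDiff_const
  hasCompactSupport' := (φ.hasCompactSupport.fderiv ℝ).comp_left (g := fun L : Plane →L[ℝ] ℝ => L v) rfl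
  tsupport_subset' :=
    (closure_minimal (s := Function.support fun x => fderiv ℝ φ x v)
      (fun x hx => tsupport_fderiv_subset ℝ
      (subset_tsupport _ fun h => hx (by simp [h])))
      (isClosed_tsupport _)).trans φ.tsupport_subset

theorem directionalDeriv_apply (φ : 𝓓(Ω, ℝ)) (v x : Plane) :
    directionalDeriv φ v x = fderiv ℝ φ x v := rfl

theorem fderiv_directionalDeriv_comm (φ : 𝓓(Ω, ℝ)) (v w x : Plane) :
    fderiv ℝ (directionalDeriv φ v) x w = fderiv ℝ (directionalDeriv φ w) x v := by
  have h : ∀ v w, fderiv ℝ (directionalDeriv φ v) x w = fderiv ℝ (fderiv ℝ φ) x w v := by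
    intro v w
    have hd : DifferentiableAt ℝ (fderiv ℝ φ) x :=
      ((contDiff_testFunction φ).fderiv_right (m := 1) (by norm_cast)).differentiable one_ne_zero x
    have := (hd.hasFDerivAt.clm_apply (hasFDerivAt_const v x)).fderiv
    change fderiv ℝ (fun y => fderiv ℝ φ y v) x w = _
    rw [this]
    simp
  rw [h, h]
  exact ((contDiff_testFunction φ).contDiffAt.isSymmSndFDerivAt (by simp; norm_cast)) w v

theorem integrable_mul_of_memLp {f : Plane → ℝ} {ψ : Plane → ℝ}
    (hf : MemLp f 2 (volume.restrict (Ω : Set Plane)))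
    (hψ : MemLp ψ 2 (volume.restrict (Ω : Set Plane))) (h0 : ∀ x, x ∉ Ω → ψ x = 0) :
    Integrable fun x => f x * ψ x := by
  have h : IntegrableOn (fun x => f x * ψ x) (Ω : Set Plane) := hf.integrable_mul hψ
  refine (integrableOn_iff_integrable_of_support_subset fun x hx => ?_).1 h
  by_contra hx'
  exact hx (by simp [h0 x hx'])

/-- A classical gradient on `Ω` is a weak gradient. -/
theorem hasWeakGrad_of_hasGradientAt {q : L2 Ω} {g : L2vec Ω} {f : Plane → ℝ} {k : Plane → Plane}
    (hf : ∀ x ∈ Ω, HasGradientAt f (k x) x)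
    (hq : q =ᵐ[volume.restrict (Ω : Set Plane)] f)
    (hg : g =ᵐ[volume.restrict (Ω : Set Plane)] k) : HasWeakGrad q g := by
  intro φ i
  let v : Plane := EuclideanSpace.single i 1
  have hfL : MemLp f 2 (volume.restrict (Ω : Set Plane)) := (Lp.memLp q).ae_eq hq
  have hkL : MemLp k 2 (volume.restrict (Ω : Set Plane)) := (Lp.memLp g).ae_eq hg
  have hkiL : MemLp (fun x => k x i) 2 (volume.restrict (Ω : Set Plane)) :=
    (EuclideanSpace.proj (𝕜 := ℝ) i).comp_memLp' hkL
  have hfd : ∀ x ∈ Ω, fderiv ℝ f x v = k x i := by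
    intro x hx
    rw [← gradient_apply, (hf x hx).gradient]
  have hmul : ∀ x, fderiv ℝ f x v * φ x = k x i * φ x := by
    intro x
    by_cases hx : x ∈ Ω
    · rw [hfd x hx]
    · simp [testFunction_eq_zero φ hx]
  have hibp := integral_mul_fderiv_eq_neg_fderiv_mul_of_integrable (μ := volume) (f := f) (g := φ)
    (v := v)
    (by
      simp only [hmul]
      exact integrable_mul_of_memLp hkiL (memLp_testFunction φ)
        fun x hx => testFunction_eq_zero φ hx)
    (integrable_mul_of_memLp hfL (memLp_testFunction (directionalDeriv φ v))
      fun x hx => testFunction_eq_zero (directionalDeriv φ v) hx)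
    (integrable_mul_of_memLp hfL (memLp_testFunction φ) fun x hx => testFunction_eq_zero φ hx)
    (fun x hx => (hf x (φ.tsupport_subset hx)).differentiableAt)
    (fun x _ => (contDiff_testFunction φ).differentiable (by simp) x)
  simp only [hmul] at hibp
  have e1 : ∫ x in (Ω : Set Plane), q x * gradient φ x i = ∫ x, f x * fderiv ℝ φ x v := by
    rw [← setIntegral_eq_integral_of_forall_compl_eq_zero (s := (Ω : Set Plane))
      (f := fun x => f x * fderiv ℝ φ x v) fun x hx => by
        rw [fderiv_testFunction_eq_zero φ hx]; simp]
    refine integral_congr_ae ?_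
    filter_upwards [hq] with x hx
    rw [hx, gradient_apply]
  have e2 : ∫ x in (Ω : Set Plane), g x i * φ x = ∫ x, k x i * φ x := by
    rw [← setIntegral_eq_integral_of_forall_compl_eq_zero (s := (Ω : Set Plane))
      (f := fun x => k x i * φ x) fun x hx => by rw [testFunction_eq_zero φ hx, mul_zero]]
    refine integral_congr_ae ?_
    filter_upwards [hg] with x hx
    rw [hx]
  rw [e1, e2, hibp]

/-- The class of a test function in `L²(Ω)`. -/
noncomputable def testL2 (φ : 𝓓(Ω, ℝ)) : L2 Ω := (memLp_testFunction φ).toLp φ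

/-- The class in `L²(Ω)²` of the gradient of a test function. -/
noncomputable def testGrad (φ : 𝓓(Ω, ℝ)) : L2vec Ω := (memLp_gradient_testFunction φ).toLp (gradient φ)

theorem testL2_ae_eq (φ : 𝓓(Ω, ℝ)) : testL2 φ =ᵐ[volume.restrict (Ω : Set Plane)] φ :=
  (memLp_testFunction φ).coeFn_toLp

theorem testGrad_ae_eq (φ : 𝓓(Ω, ℝ)) :
    testGrad φ =ᵐ[volume.restrict (Ω : Set Plane)] gradient φ :=
  (memLp_gradient_testFunction φ).coeFn_toLp

theorem hasWeakGrad_testL2 (φ : 𝓓(Ω, ℝ)) : HasWeakGrad (testL2 φ) (testGrad φ) :=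
  hasWeakGrad_of_hasGradientAt
    (fun x _ => ((contDiff_testFunction φ).differentiable (by simp) x).hasGradientAt)
    (testL2_ae_eq φ) (testGrad_ae_eq φ)

theorem testL2_mem_H1 (φ : 𝓓(Ω, ℝ)) : testL2 φ ∈ H1 Ω := ⟨_, hasWeakGrad_testL2 φ⟩

theorem testL2_mem_H10 (φ : 𝓓(Ω, ℝ)) : testL2 φ ∈ H10 Ω := by
  refine ⟨testL2_mem_H1 φ, fun _ => φ, ?_, ?_⟩
  · have : (fun x => φ x - testL2 φ x) =ᵐ[volume.restrict (Ω : Set Plane)] 0 := by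
      filter_upwards [testL2_ae_eq φ] with x hx
      simp [hx]
    simp only [eLpNorm_congr_ae this, eLpNorm_zero]
    exact tendsto_const_nhds
  · rw [(hasWeakGrad_testL2 φ).weakGrad_eq]
    have : (fun x => gradient φ x - testGrad φ x) =ᵐ[volume.restrict (Ω : Set Plane)] 0 := by
      filter_upwards [testGrad_ae_eq φ] with x hx
      simp [hx]
    simp only [eLpNorm_congr_ae this, eLpNorm_zero]
    exact tendsto_const_nhds

theorem testL2_zero : testL2 (0 : 𝓓(Ω, ℝ)) = 0 := by
  apply Lp.ext
  filter_upwards [testL2_ae_eq (0 : 𝓓(Ω, ℝ)), Lp.coeFn_zero ℝ 2 (volume.restrict (Ω : Set Plane))]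
    with x h1 h2
  rw [h1, h2]
  rfl

theorem zero_mem_H10 : (0 : L2 Ω) ∈ H10 Ω := testL2_zero (Ω := Ω) ▸ testL2_mem_H10 0

theorem weakGrad_zero : weakGrad (0 : L2 Ω) = 0 := by
  refine HasWeakGrad.weakGrad_eq fun φ i => ?_
  have h1 : ∫ x in (Ω : Set Plane), (0 : L2 Ω) x * gradient φ x i = 0 := by
    refine integral_eq_zero_of_ae ?_
    filter_upwards [Lp.coeFn_zero ℝ 2 (volume.restrict (Ω : Set Plane))] with x hx
    rw [hx]
    simp
  have h2 : ∫ x in (Ω : Set Plane), (0 : L2vec Ω) x i * φ x = 0 := by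
    refine integral_eq_zero_of_ae ?_
    filter_upwards [Lp.coeFn_zero Plane 2 (volume.restrict (Ω : Set Plane))] with x hx
    rw [hx]
    simp
  rw [h1, h2, neg_zero]

/-! ### Curls of functions in `H¹₀(Ω)` -/

theorem quarterTurn_apply_zero (x : Plane) : quarterTurn x 0 = x 1 := by
  simp [quarterTurn, Matrix.ofLp_toEuclideanCLM, Matrix.mulVec, dotProduct]

theorem quarterTurn_apply_one (x : Plane) : quarterTurn x 1 = -x 0 := by
  simp [quarterTurn, Matrix.ofLp_toEuclideanCLM, Matrix.mulVec, dotProduct]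

theorem inner_plane (x y : Plane) : inner ℝ x y = x 0 * y 0 + x 1 * y 1 := by
  simp [PiLp.inner_apply, Fin.sum_univ_two, mul_comm]

theorem weakCurl_zero : weakCurl (0 : L2 Ω) = 0 := by
  rw [weakCurl, weakGrad_zero]
  exact map_zero (quarterTurn.compLpL 2 (volume.restrict (Ω : Set Plane)))

/-- The curl of a test function is orthogonal to all gradients, because second derivatives
commute. -/
theorem inner_quarterTurn_testGrad_eq_zero (φ : 𝓓(Ω, ℝ)) {r : L2 Ω} {g : L2vec Ω}
    (h : HasWeakGrad r g) : inner ℝ (quarterTurn.compLp (testGrad φ)) g = 0 := by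
  let v : Fin 2 → Plane := fun i => EuclideanSpace.single i 1
  have hint : ∀ i j, Integrable (fun x => g x i * directionalDeriv φ (v j) x)
      (volume.restrict (Ω : Set Plane)) := fun i j =>
    (integrable_mul_of_memLp ((EuclideanSpace.proj (𝕜 := ℝ) i).comp_memLp' (Lp.memLp g))
      (memLp_testFunction (directionalDeriv φ (v j)))
      fun x hx => testFunction_eq_zero _ hx).restrict
  have h0 := h (directionalDeriv φ (v 1)) 0
  have h1 := h (directionalDeriv φ (v 0)) 1
  simp only [gradient_apply] at h0 h1
  have hsymm : ∀ x, fderiv ℝ (directionalDeriv φ (v 1)) x (v 0) =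
      fderiv ℝ (directionalDeriv φ (v 0)) x (v 1) := fun x => fderiv_directionalDeriv_comm φ _ _ x
  have h2 : ∫ x in (Ω : Set Plane), g x 0 * directionalDeriv φ (v 1) x =
      ∫ x in (Ω : Set Plane), g x 1 * directionalDeriv φ (v 0) x := by
    refine neg_injective (h0.symm.trans (Eq.trans ?_ h1))
    exact integral_congr_ae (Eventually.of_forall fun x => congrArg (r x * ·) (hsymm x))
  rw [L2.inner_def, ← sub_eq_zero.2 h2, ← integral_sub (hint 0 1) (hint 1 0)]
  refine integral_congr_ae ?_
  filter_upwards [quarterTurn.coeFn_compLp (testGrad φ), testGrad_ae_eq φ] with x hx1 hx2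
  rw [hx1, hx2, inner_plane, quarterTurn_apply_zero, quarterTurn_apply_one, gradient_apply,
    gradient_apply, directionalDeriv_apply, directionalDeriv_apply]
  ring

/-- Curls of `H¹₀(Ω)` are orthogonal to gradients of `H¹(Ω)`, by density of test functions. -/
theorem inner_weakCurl_weakGrad {q r : L2 Ω} (hq : q ∈ H10 Ω) (hr : r ∈ H1 Ω) :
    inner ℝ (weakCurl q) (weakGrad r) = 0 := by
  obtain ⟨-, φ, -, hφ⟩ := hq
  have hlim : Tendsto (fun k => testGrad (φ k)) atTop (𝓝 (weakGrad q)) := by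
    refine (Lp.tendsto_Lp_iff_tendsto_eLpNorm' _ _).2 (hφ.congr fun k => eLpNorm_congr_ae ?_)
    filter_upwards [testGrad_ae_eq (φ k)] with x hx
    simp [hx]
  let T : L2vec Ω →L[ℝ] L2vec Ω := quarterTurn.compLpL 2 (volume.restrict (Ω : Set Plane))
  have hlim2 : Tendsto (fun k => inner ℝ (T (testGrad (φ k))) (weakGrad r)) atTop
      (𝓝 (inner ℝ (T (weakGrad q)) (weakGrad r))) :=
    ((T.continuous.tendsto _).comp hlim).inner tendsto_const_nhds
  refine tendsto_nhds_unique hlim2 (tendsto_const_nhds.congr fun k => ?_)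
  exact (inner_quarterTurn_testGrad_eq_zero (φ k) (hasWeakGrad_weakGrad hr)).symm

theorem inner_testGrad (v : L2vec Ω) (φ : 𝓓(Ω, ℝ)) :
    inner ℝ v (testGrad φ) = ∫ x in (Ω : Set Plane), inner ℝ (v x) (gradient φ x) := by
  rw [L2.inner_def]
  refine integral_congr_ae ?_
  filter_upwards [testGrad_ae_eq φ] with x hx
  rw [hx]

theorem hasWeakDiv_zero_iff {v : L2vec Ω} :
    HasWeakDiv v 0 ↔ ∀ φ : 𝓓(Ω, ℝ), inner ℝ v (testGrad φ) = 0 := by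
  refine forall_congr' fun φ => ?_
  have h2 : ∫ x in (Ω : Set Plane), (0 : L2 Ω) x * φ x = 0 := by
    refine integral_eq_zero_of_ae ?_
    filter_upwards [Lp.coeFn_zero ℝ 2 (volume.restrict (Ω : Set Plane))] with x hx
    rw [hx]
    simp
  rw [h2, neg_zero, inner_testGrad]

theorem hasWeakDiv_weakCurl {q : L2 Ω} (hq : q ∈ H10 Ω) : HasWeakDiv (weakCurl q) 0 := by
  refine hasWeakDiv_zero_iff.2 fun φ => ?_
  rw [← (hasWeakGrad_testL2 φ).weakGrad_eq]
  exact inner_weakCurl_weakGrad hq (testL2_mem_H1 φ)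

theorem weakCurl_mem_H0div {q : L2 Ω} (hq : q ∈ H10 Ω) : weakCurl q ∈ H0div Ω := by
  refine ⟨⟨0, hasWeakDiv_weakCurl hq⟩, fun r hr => ?_⟩
  rw [normalTrace, (hasWeakDiv_weakCurl hq).weakDiv_eq, inner_zero_left, zero_add]
  exact inner_weakCurl_weakGrad hq hr

/-- On a bounded domain a function of `H¹₀(Ω)` with vanishing gradient vanishes, by the
Gagliardo-Nirenberg-Sobolev inequality for test functions. -/
theorem eq_zero_of_weakGrad_eq_zero (hb : Bornology.IsBounded (Ω : Set Plane)) {q : L2 Ω}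
    (hq : q ∈ H10 Ω) (h : weakGrad q = 0) : q = 0 := by
  obtain ⟨-, φ, hφ, hφg⟩ := hq
  have hfin : volume (Ω : Set Plane) ≠ ⊤ := hb.measure_lt_top.ne
  rw [h] at hφg
  let C := eLpNormLESNormFDerivOneConst (volume : Measure Plane) (2 : NNReal)
  have hconj : NNReal.HolderConjugate (Module.finrank ℝ Plane) (2 : NNReal) := by
    rw [finrank_euclideanSpace_fin]
    exact_mod_cast NNReal.HolderConjugate.two_two
  let m : ENNReal := volume (Ω : Set Plane) ^ (1 / (1 : ENNReal).toReal - 1 / (2 : ENNReal).toReal)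
  have hm : m ≠ ⊤ := ENNReal.rpow_ne_top_of_nonneg (by norm_num) hfin
  have hbound : ∀ k, eLpNorm (φ k) 2 (volume.restrict (Ω : Set Plane)) ≤
      C * (eLpNorm (fun x => gradient (φ k) x - (0 : L2vec Ω) x) 2
        (volume.restrict (Ω : Set Plane)) * m) := by
    intro k
    have e1 : eLpNorm (fderiv ℝ (φ k)) 1 volume =
        eLpNorm (gradient (φ k)) 1 (volume.restrict (Ω : Set Plane)) := by
      rw [eLpNorm_congr_norm_ae (g := gradient (φ k))
        (Eventually.of_forall fun x => (norm_gradient (φ k) x).symm),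
        eLpNorm_restrict_eq_of_support_subset]
      intro x hx
      by_contra hx'
      refine hx ?_
      rw [← norm_eq_zero, norm_gradient, fderiv_testFunction_eq_zero (φ k) hx', norm_zero]
    have e2 : eLpNorm (gradient (φ k)) 2 (volume.restrict (Ω : Set Plane)) =
        eLpNorm (fun x => gradient (φ k) x - (0 : L2vec Ω) x) 2
          (volume.restrict (Ω : Set Plane)) := by
      refine eLpNorm_congr_ae ?_
      filter_upwards [Lp.coeFn_zero Plane 2 (volume.restrict (Ω : Set Plane))] with x hx
      rw [hx]
      simp
    have e3 : eLpNorm (φ k) 2 volume ≤ C * eLpNorm (fderiv ℝ (φ k)) 1 volume :=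
      eLpNorm_le_eLpNorm_fderiv_one volume
        ((contDiff_testFunction (φ k)).of_le (by norm_cast)) (φ k).hasCompactSupport hconj
    have e4 := eLpNorm_le_eLpNorm_mul_rpow_measure_univ (p := 1) (q := 2)
      (μ := volume.restrict (Ω : Set Plane)) (by norm_num)
      (continuous_gradient_testFunction (φ k)).aestronglyMeasurable
    rw [Measure.restrict_apply_univ] at e4
    calc eLpNorm (φ k) 2 (volume.restrict (Ω : Set Plane))
        ≤ eLpNorm (φ k) 2 volume := eLpNorm_mono_measure _ Measure.restrict_le_self
      _ ≤ C * eLpNorm (fderiv ℝ (φ k)) 1 volume := e3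
      _ ≤ _ := by
        rw [e1, ← e2]
        gcongr
  have hlim : Tendsto (fun k => eLpNorm (φ k) 2 (volume.restrict (Ω : Set Plane))) atTop
      (𝓝 0) := by
    refine tendsto_of_tendsto_of_tendsto_of_le_of_le tendsto_const_nhds ?_
      (fun _ => zero_le) hbound
    have := ENNReal.Tendsto.const_mul (a := (C : ENNReal))
      (ENNReal.Tendsto.mul_const (b := m) hφg (Or.inr hm)) (Or.inr ENNReal.coe_ne_top)
    simpa using this
  have ht : Tendsto (fun k => testL2 (φ k)) atTop (𝓝 q) := by
    refine (Lp.tendsto_Lp_iff_tendsto_eLpNorm' _ _).2 (hφ.congr fun k => eLpNorm_congr_ae ?_)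
    filter_upwards [testL2_ae_eq (φ k)] with x hx
    simp [hx]
  have ht0 : Tendsto (fun k => testL2 (φ k)) atTop (𝓝 0) := by
    refine (Lp.tendsto_Lp_iff_tendsto_eLpNorm' _ _).2 (hlim.congr fun k => eLpNorm_congr_ae ?_)
    filter_upwards [testL2_ae_eq (φ k), Lp.coeFn_zero ℝ 2 (volume.restrict (Ω : Set Plane))]
      with x hx hx0
    rw [Pi.sub_apply, hx, hx0]
    simp
  exact tendsto_nhds_unique ht ht0

theorem eq_zero_of_weakCurl_eq_zero (hb : Bornology.IsBounded (Ω : Set Plane)) {q : L2 Ω}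
    (hq : q ∈ H10 Ω) (h : weakCurl q = 0) : q = 0 := by
  refine eq_zero_of_weakGrad_eq_zero hb hq (Lp.ext ?_)
  have hc := quarterTurn.coeFn_compLp (weakGrad q)
  change weakCurl q =ᵐ[_] _ at hc
  rw [h] at hc
  filter_upwards [hc, Lp.coeFn_zero Plane 2 (volume.restrict (Ω : Set Plane))] with x h1 h2
  rw [h2] at h1 ⊢
  have e0 := congrArg (fun y : Plane => y 0) h1
  have e1 := congrArg (fun y : Plane => y 1) h1
  simp only [quarterTurn_apply_zero, quarterTurn_apply_one] at e0 e1
  ext i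
  fin_cases i
  · simpa using e1
  · simpa using e0.symm

/-! ### Fields without divergence and rotation -/

/-- The standard identification of the complex plane with the Euclidean plane. -/
noncomputable def complexPlane : ℂ ≃ₗᵢ[ℝ] Plane := Complex.orthonormalBasisOneI.repr

theorem complexPlane_apply_zero (z : ℂ) : complexPlane z 0 = z.re := by
  simp [complexPlane, Complex.orthonormalBasisOneI_repr_apply]

theorem complexPlane_apply_one (z : ℂ) : complexPlane z 1 = z.im := by
  simp [complexPlane, Complex.orthonormalBasisOneI_repr_apply]

theorem complexPlane_symm_apply (x : Plane) : complexPlane.symm x = ⟨x 0, x 1⟩ := by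
  rw [LinearIsometryEquiv.symm_apply_eq]
  ext i
  fin_cases i
  · exact (complexPlane_apply_zero ⟨x 0, x 1⟩).symm
  · exact (complexPlane_apply_one ⟨x 0, x 1⟩).symm

theorem complexPlane_one : complexPlane 1 = EuclideanSpace.single 0 1 := by
  ext i
  fin_cases i
  · simpa using complexPlane_apply_zero 1
  · simpa using complexPlane_apply_one 1

theorem complexPlane_I : complexPlane Complex.I = EuclideanSpace.single 1 1 := by
  ext i
  fin_cases i
  · simpa using complexPlane_apply_zero Complex.I
  · simpa using complexPlane_apply_one Complex.I

theorem measurableEmbedding_complexPlane : MeasurableEmbedding complexPlane :=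
  complexPlane.toHomeomorph.measurableEmbedding

/-- The complex field `u₁ - i u₂` of a plane field `u`, extended by zero outside `Ω`. -/
noncomputable def conjField (u : L2vec Ω) : ℂ → ℂ :=
  (complexPlane ⁻¹' (Ω : Set Plane)).indicator fun z => ⟨u (complexPlane z) 0, -u (complexPlane z) 1⟩

theorem conjField_of_mem (u : L2vec Ω) {z : ℂ} (hz : complexPlane z ∈ Ω) :
    conjField u z = ⟨u (complexPlane z) 0, -u (complexPlane z) 1⟩ :=
  Set.indicator_of_mem (s := complexPlane ⁻¹' (Ω : Set Plane)) hz _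

theorem isOpen_preimage_complexPlane (Ω : Opens Plane) :
    IsOpen (complexPlane ⁻¹' (Ω : Set Plane)) :=
  Ω.isOpen.preimage complexPlane.continuous

theorem integrable_conjField (hb : Bornology.IsBounded (Ω : Set Plane)) (u : L2vec Ω) :
    Integrable (conjField u) := by
  have hfin : IsFiniteMeasure (volume.restrict (Ω : Set Plane)) :=
    ⟨by rw [Measure.restrict_apply_univ]; exact hb.measure_lt_top⟩
  have hu : IntegrableOn u (Ω : Set Plane) := (Lp.memLp u).integrable (by norm_num)
  let T : Plane →L[ℝ] ℂ := Complex.conjCLE.toContinuousLinearMap.comp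
    complexPlane.symm.toContinuousLinearEquiv.toContinuousLinearMap
  have hT : IntegrableOn (fun x => T (u x)) (Ω : Set Plane) := T.integrable_comp hu
  refine (integrable_indicator_iff (isOpen_preimage_complexPlane Ω).measurableSet).2 ?_
  refine ((complexPlane.measurePreserving.integrableOn_comp_preimage
    measurableEmbedding_complexPlane).2 hT).congr_fun (fun z _ => ?_)
    (isOpen_preimage_complexPlane Ω).measurableSet
  change (starRingEnd ℂ) (complexPlane.symm (u (complexPlane z))) = _
  rw [complexPlane_symm_apply]
  rfl

/-- The weak equations `div u = 0` and `rot u = 0` are the weak Cauchy-Riemann equations for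
`u₁ - i u₂`. -/
theorem weak_cauchyRiemann_conjField (hb : Bornology.IsBounded (Ω : Set Plane)) {u : L2vec Ω}
    (hdiv : ∀ φ : 𝓓(Ω, ℝ), inner ℝ u (testGrad φ) = 0)
    (hrot : ∀ φ : 𝓓(Ω, ℝ), inner ℝ u (quarterTurn.compLp (testGrad φ)) = 0)
    {ψ : ℂ → ℝ} (hψ : ContDiff ℝ ∞ ψ) (hψc : HasCompactSupport ψ)
    (hψs : tsupport ψ ⊆ complexPlane ⁻¹' (Ω : Set Plane)) :
    ∫ z, fderiv ℝ ψ z Complex.I • conjField u z =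
      Complex.I * ∫ z, fderiv ℝ ψ z 1 • conjField u z := by
  let φ : 𝓓(Ω, ℝ) :=
    { toFun := fun x => ψ (complexPlane.symm x)
      contDiff' := hψ.comp complexPlane.symm.contDiff
      hasCompactSupport' := hψc.comp_homeomorph complexPlane.symm.toHomeomorph
      tsupport_subset' := by
        intro x hx
        have h1 : complexPlane.symm x ∈ tsupport ψ :=
          tsupport_comp_subset_preimage ψ complexPlane.symm.continuous hx
        simpa using hψs h1 }
  have hφ : ∀ z v, fderiv ℝ φ (complexPlane z) (complexPlane v) = fderiv ℝ ψ z v := by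
    intro z v
    have h1 : HasFDerivAt ψ (fderiv ℝ ψ z) (complexPlane.symm (complexPlane z)) := by
      rw [LinearIsometryEquiv.symm_apply_apply]
      exact (hψ.differentiable (by simp) z).hasFDerivAt
    have h2 : HasFDerivAt φ _ (complexPlane z) :=
      h1.comp (complexPlane z)
        complexPlane.symm.toContinuousLinearEquiv.toContinuousLinearMap.hasFDerivAt
    rw [h2.fderiv]
    change fderiv ℝ ψ z (complexPlane.symm (complexPlane v)) = _
    rw [LinearIsometryEquiv.symm_apply_apply]
  have hφ0 : ∀ z, gradient φ (complexPlane z) 0 = fderiv ℝ ψ z 1 := fun z => by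
    rw [gradient_apply, ← complexPlane_one, hφ]
  have hφ1 : ∀ z, gradient φ (complexPlane z) 1 = fderiv ℝ ψ z Complex.I := fun z => by
    rw [gradient_apply, ← complexPlane_I, hφ]
  let a : Plane → ℝ := fun x => inner ℝ (u x) (gradient φ x)
  let b : Plane → ℝ := fun x => inner ℝ (u x) (quarterTurn (gradient φ x))
  have ha : ∫ x in (Ω : Set Plane), a x = 0 := by rw [← hdiv φ, inner_testGrad]
  have hb0 : ∫ x in (Ω : Set Plane), b x = 0 := by
    rw [← hrot φ, L2.inner_def]
    refine integral_congr_ae ?_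
    filter_upwards [quarterTurn.coeFn_compLp (testGrad φ), testGrad_ae_eq φ] with x hx1 hx2
    rw [hx1, hx2]
  have hai : IntegrableOn a (Ω : Set Plane) :=
    (L2.integrable_inner (𝕜 := ℝ) u (testGrad φ)).congr <| by
      filter_upwards [testGrad_ae_eq φ] with x hx
      rw [hx]
  have hbi : IntegrableOn b (Ω : Set Plane) :=
    (L2.integrable_inner (𝕜 := ℝ) u (quarterTurn.compLp (testGrad φ))).congr <| by
      filter_upwards [quarterTurn.coeFn_compLp (testGrad φ), testGrad_ae_eq φ] with x hx1 hx2
      rw [hx1, hx2]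
  have hF := integrable_conjField hb u
  have hint : ∀ v, Integrable fun z => fderiv ℝ ψ z v • conjField u z := by
    intro v
    have hc : Continuous fun z => fderiv ℝ ψ z v :=
      (hψ.continuous_fderiv (by simp)).clm_apply continuous_const
    obtain ⟨C, hC⟩ := hc.bounded_above_of_compact_support
      ((hψc.fderiv ℝ).comp_left (g := fun L : ℂ →L[ℝ] ℝ => L v) rfl)
    exact hF.bdd_smul C hc.aestronglyMeasurable (Eventually.of_forall hC)
  rw [← integral_const_mul, ← sub_eq_zero, ← integral_sub (hint _) ((hint _).const_mul _)]
  have hpt : ∀ z, fderiv ℝ ψ z Complex.I • conjField u z -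
      Complex.I * fderiv ℝ ψ z 1 • conjField u z =
      (complexPlane ⁻¹' (Ω : Set Plane)).indicator
        (fun z => (b (complexPlane z) : ℂ) - (a (complexPlane z) : ℂ) * Complex.I) z := by
    intro z
    by_cases hz : complexPlane z ∈ Ω
    · rw [Set.indicator_of_mem (show z ∈ complexPlane ⁻¹' (Ω : Set Plane) from hz),
        conjField_of_mem u hz]
      simp only [a, b, inner_plane, quarterTurn_apply_zero, quarterTurn_apply_one, hφ0, hφ1]
      apply Complex.ext <;> simp <;> ring
    · have hz' : z ∉ complexPlane ⁻¹' (Ω : Set Plane) := hz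
      rw [Set.indicator_of_notMem hz', conjField, Set.indicator_of_notMem hz']
      simp
  simp only [hpt]
  rw [integral_indicator (isOpen_preimage_complexPlane Ω).measurableSet,
    complexPlane.measurePreserving.setIntegral_preimage_emb measurableEmbedding_complexPlane
      (fun x => (b x : ℂ) - (a x : ℂ) * Complex.I),
    integral_sub hbi.ofReal (hai.ofReal.mul_const _), integral_mul_const,
    integral_complex_ofReal, integral_complex_ofReal, ha, hb0]
  simp

/-- On a bounded simply connected open set a square integrable field without divergence and
rotation is the classical gradient of a function, the real part of a primitive of the holomorphic
function `u₁ - i u₂`. -/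
theorem exists_potential (hb : Bornology.IsBounded (Ω : Set Plane)) (hsc : SimplyConnectedSpace Ω)
    {u : L2vec Ω} (hdiv : ∀ φ : 𝓓(Ω, ℝ), inner ℝ u (testGrad φ) = 0)
    (hrot : ∀ φ : 𝓓(Ω, ℝ), inner ℝ u (quarterTurn.compLp (testGrad φ)) = 0) :
    ∃ (q : Plane → ℝ) (k : Plane → Plane), (∀ x ∈ Ω, HasGradientAt q (k x) x) ∧
      u =ᵐ[volume.restrict (Ω : Set Plane)] k := by
  let U : Set ℂ := complexPlane ⁻¹' (Ω : Set Plane)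
  have hU : IsOpen U := isOpen_preimage_complexPlane Ω
  obtain ⟨f, hf, hfu⟩ := exists_differentiableOn_ae_eq_of_weak_cauchyRiemann hU
    (integrable_conjField hb u)
    fun ψ h1 h2 h3 => weak_cauchyRiemann_conjField hb hdiv hrot h1 h2 h3
  have hUsc : SimplyConnectedSpace U :=
    (complexPlane.toHomeomorph.isSimplyConnected_preimage (s := (Ω : Set Plane))).2 hsc
  let η : ℂ → ℂ →L[ℝ] ℂ := fun z => (ContinuousLinearMap.toSpanSingleton ℂ (f z)).restrictScalars ℝ
  obtain ⟨G, hG⟩ := exists_hasFDerivAt_of_locally hU hUsc (η := η) (by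
    intro z hz
    obtain ⟨r, hr, hsub⟩ := Metric.isOpen_iff.1 hU z hz
    obtain ⟨g, hg⟩ := (hf.mono hsub).isExactOn_ball
    exact ⟨r, hr, g, fun y hy => (hg y hy).hasFDerivAt.restrictScalars ℝ⟩)
  let k : Plane → Plane := fun x => complexPlane (starRingEnd ℂ (f (complexPlane.symm x)))
  refine ⟨fun x => (G (complexPlane.symm x)).re, k, fun x hx => ?_, ?_⟩
  · have hx' : complexPlane.symm x ∈ U := by simpa [U] using hx
    have h1 := Complex.reCLM.hasFDerivAt.comp x ((hG _ hx').comp x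
      complexPlane.symm.toContinuousLinearEquiv.toContinuousLinearMap.hasFDerivAt)
    rw [hasGradientAt_iff_hasFDerivAt]
    refine h1.congr_fderiv ?_
    ext v
    rw [InnerProductSpace.toDual_apply_apply, inner_plane]
    simp only [k, complexPlane_apply_zero, complexPlane_apply_one]
    change (complexPlane.symm v * f (complexPlane.symm x)).re = _
    rw [complexPlane_symm_apply v]
    simp
    ring
  · have h1 := complexPlane.symm.measurePreserving.quasiMeasurePreserving.ae hfu
    rw [EventuallyEq, ae_restrict_iff' Ω.isOpen.measurableSet]
    filter_upwards [h1] with x hx hxΩ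
    have hx' : complexPlane.symm x ∈ U := by simpa [U] using hxΩ
    have h2 := hx hx'
    rw [conjField_of_mem u (by simpa using hxΩ), LinearIsometryEquiv.apply_symm_apply] at h2
    simp only [k, ← h2]
    ext i
    fin_cases i
    · simp [complexPlane_apply_zero]
    · simp [complexPlane_apply_one]

/-- On a bounded simply connected domain a field without divergence, rotation and normal trace
vanishes. -/
theorem eq_zero_of_harmonic_field (hb : Bornology.IsBounded (Ω : Set Plane))
    (hsc : SimplyConnectedSpace Ω) {u : L2vec Ω} (hu : u ∈ H0div Ω) (hdiv : weakDiv u = 0)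
    (hrot : ∀ q ∈ H10 Ω, inner ℝ u (weakCurl q) = 0) : u = 0 := by
  have hdiv0 : HasWeakDiv u 0 := hdiv ▸ hasWeakDiv_weakDiv hu.1
  obtain ⟨q, k, hq, hk⟩ := exists_potential hb hsc (hasWeakDiv_zero_iff.1 hdiv0) fun φ => by
    have := hrot _ (testL2_mem_H10 φ)
    rwa [weakCurl, (hasWeakGrad_testL2 φ).weakGrad_eq] at this
  have hfin : IsFiniteMeasure (volume.restrict (Ω : Set Plane)) :=
    ⟨by rw [Measure.restrict_apply_univ]; exact hb.measure_lt_top⟩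
  -- The potential `q` need not be square integrable, but its arctangent is bounded and has the
  -- gradient `u / (1 + q²)`.
  let w : Plane → ℝ := fun x => 1 / (1 + q x ^ 2)
  have hw0 : ∀ x, 0 < w x := fun x => by positivity
  have hw1 : ∀ x, w x ≤ 1 := fun x => by
    rw [div_le_one (by positivity)]
    linarith [sq_nonneg (q x)]
  have hqc : ContinuousOn q (Ω : Set Plane) := fun x hx =>
    (hq x hx).continuousAt.continuousWithinAt
  have hqm : AEMeasurable q (volume.restrict (Ω : Set Plane)) :=
    hqc.aemeasurable Ω.isOpen.measurableSet
  have hfL : MemLp (fun x => Real.arctan (q x)) 2 (volume.restrict (Ω : Set Plane)) :=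
    MemLp.of_bound (Real.continuous_arctan.measurable.comp_aemeasurable hqm).aestronglyMeasurable
      (Real.pi / 2) (Eventually.of_forall fun x => abs_le.2
        ⟨(Real.neg_pi_div_two_lt_arctan _).le, (Real.arctan_lt_pi_div_two _).le⟩)
  have hwm : AEStronglyMeasurable w (volume.restrict (Ω : Set Plane)) :=
    (((hqm.pow_const 2).const_add 1).const_div 1).aestronglyMeasurable
  have hgL : MemLp (fun x => w x • u x) 2 (volume.restrict (Ω : Set Plane)) := by
    refine (Lp.memLp u).of_le (hwm.smul (Lp.aestronglyMeasurable u))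
      (Eventually.of_forall fun x => ?_)
    rw [norm_smul, Real.norm_of_nonneg (hw0 x).le]
    exact mul_le_of_le_one_left (norm_nonneg _) (hw1 x)
  have hgrad : HasWeakGrad (hfL.toLp _) (hgL.toLp _) := by
    refine hasWeakGrad_of_hasGradientAt (f := fun x => Real.arctan (q x))
      (k := fun x => w x • k x) (fun x hx => ?_) hfL.coeFn_toLp ?_
    · rw [hasGradientAt_iff_hasFDerivAt, map_smul]
      exact (hq x hx).hasFDerivAt.arctan
    · filter_upwards [hgL.coeFn_toLp, hk] with x h1 h2
      rw [h1, h2]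
  have htr := hu.2 _ ⟨_, hgrad⟩
  rw [normalTrace, hdiv, inner_zero_left, zero_add, hgrad.weakGrad_eq, L2.inner_def] at htr
  have hval : (fun x => inner ℝ (u x) (hgL.toLp _ x)) =ᵐ[volume.restrict (Ω : Set Plane)]
      fun x => w x * ‖u x‖ ^ 2 := by
    filter_upwards [hgL.coeFn_toLp] with x hx
    rw [hx, inner_smul_right, real_inner_self_eq_norm_sq]
  have hzero := (integral_eq_zero_iff_of_nonneg_ae
    (hval.mono fun x hx => (mul_nonneg (hw0 x).le (sq_nonneg _)).trans_eq hx.symm)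
    (L2.integrable_inner (𝕜 := ℝ) u _)).1 htr
  apply Lp.ext
  filter_upwards [hzero, hval, Lp.coeFn_zero Plane 2 (volume.restrict (Ω : Set Plane))]
    with x h1 h2 h3
  rw [h3]
  rw [h2] at h1
  simpa [(hw0 x).ne'] using h1

end AcousticEigenproblem

/-! ### Equivalence of the two eigenproblems -/

theorem mainTheorem12 (Ω : Opens Plane) (hΩ : IsPolygonalDomain Ω)
    (hsc : SimplyConnectedSpace Ω) :
    (∀ (lam : ℝ) (u : L2vec Ω), IsEigenpair lam u → IsMixedEigenpair lam u 0) ∧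
    (∀ (lam : ℝ) (u : L2vec Ω) (p : L2 Ω), IsMixedEigenpair lam u p →
      p = 0 ∧ IsEigenpair lam u) := by
  have hb : Bornology.IsBounded (Ω : Set Plane) := hΩ.2.1
  refine ⟨?_, ?_⟩
  · rintro lam u ⟨hu, hu0, heq, hlam⟩
    refine ⟨hu, hu0, zero_mem_H10, fun v hv => ?_, fun q hq => ?_⟩
    · rw [weakCurl_zero, inner_zero_right, add_zero, heq v hv]
    · have h := heq _ (weakCurl_mem_H0div hq)
      rw [(hasWeakDiv_weakCurl hq).weakDiv_eq, inner_zero_right] at h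
      exact (mul_eq_zero.1 h.symm).resolve_left hlam
  · rintro lam u p ⟨hu, hu0, hp, heq, hrot⟩
    have hcurl : weakCurl p = 0 := by
      have h := heq _ (weakCurl_mem_H0div hp)
      rw [(hasWeakDiv_weakCurl hp).weakDiv_eq, inner_zero_right, zero_add, hrot p hp,
        mul_zero] at h
      exact inner_self_eq_zero.1 h
    have heig : ∀ v ∈ H0div Ω, inner ℝ (weakDiv u) (weakDiv v) = lam * inner ℝ u v := by
      intro v hv
      have h := heq v hv
      rwa [hcurl, inner_zero_right, add_zero] at h
    refine ⟨eq_zero_of_weakCurl_eq_zero hb hp hcurl, hu, hu0, heig, ?_⟩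
    rintro rfl
    have hdiv : weakDiv u = 0 := by
      have h := heig u hu
      rw [zero_mul] at h
      exact inner_self_eq_zero.1 h
    exact hu0 (eq_zero_of_harmonic_field hb hsc hu hdiv hrot)
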